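/- Let $X$ be a real Banach space with topological dual $X^*$, and let $C\subseteq X$ be a closed convex set whose strong quasi relative interior $$\mathrm{sqri}(C)=\Big\{x\in C:\ \bigcup_{t\ge 0}t\,(C-x)\ \text{is a closed linear subspace of } X\Big\}$$ is nonempty. Let $F:C\times C\to\mathbb{R}$ satisfy $F(x,x)=0$ for all $x\in C$, let $F(x,\cdot)$ be convex and lower semicontinuous on $C$ for every $x\in C$, and let $F(\cdot,y)$ be concave and upper semicontinuous on $C$ for every $y\in C$. Define the set-valued operators $A^F,{}^F\!A:X\rightrightarrows X^*$ by $$A^F(x)=\{x^*\in X^*:\ F(x,y)-F(x,x)\ge\langle x^*,y-x\rangle\ \ \forall y\in C\},$$ $${}^F\!A(x)=\{x^*\in X^*:\ F(x,x)-F(y,x)\ge\langle x^*,y-x\rangle\ \ \forall y\in C\}$$ for $x\in C$, and $A^F(x)={}^F\!A(x)=\emptyset$ for $x\in X\setminus C$. Then $A^F$ is maximal monotone, that is, $\langle y^*-x^*,y-x\rangle\ge 0$ whenever $x^*\in A^F(x)$ and $y^*\in A^F(y)$, and the graph $\{(x,x^*): x^*\in A^F(x)\}$ is not properly contained in the graph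 of any monotone operator from $X$ to $X^*$. Moreover, $A^F={}^F\!A$. (It is not assumed that $F$ is monotone, i.e. that $F(x,y)+F(y,x)\le 0$.) -/

import Mathlib

namespace MonotoneBifunction

variable {X : Type*} [NormedAddCommGroup X] [NormedSpace ℝ X]

/-- The conical hull `⋃_{t ≥ 0} t • U` of a (convex) set `U`. -/
def coneHull (U : Set X) : Set X :=
  {z | ∃ t : ℝ, 0 ≤ t ∧ ∃ u ∈ U, z = t • u}

/-- The strong quasi relative interior: the points `x ∈ U` such that `cone (U - x)` is a closed
linear subspace. -/
def sqri (U : Set X) : Set X :=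
  {x | x ∈ U ∧ ∃ L : Submodule ℝ X,
    IsClosed (L : Set X) ∧ coneHull ((fun u => u - x) '' U) = (L : Set X)}

/-- The graph of a multifunction `T : X ⇉ X*`. -/
def graph (T : X → Set (StrongDual ℝ X)) : Set (X × StrongDual ℝ X) :=
  {p | p.2 ∈ T p.1}

/-- Monotone operators `T : X ⇉ X*`. -/
def IsMonotoneOperator (T : X → Set (StrongDual ℝ X)) : Prop :=
  ∀ x y : X, ∀ x' ∈ T x, ∀ y' ∈ T y, 0 ≤ (y' - x') (y - x)

/-- Maximal monotone operators: monotone operators whose graph is not properly included in the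
graph of a monotone operator. -/
def IsMaximalMonotone (T : X → Set (StrongDual ℝ X)) : Prop :=
  IsMonotoneOperator T ∧
    ∀ S : X → Set (StrongDual ℝ X), IsMonotoneOperator S → ¬ graph T ⊂ graph S

/-- The operator `A^F` of a bifunction on `C`. Only the values of `F` on `C × C` matter. -/
def rightOp (C : Set X) (F : X → X → ℝ) (x : X) : Set (StrongDual ℝ X) :=
  {x' | x ∈ C ∧ ∀ y ∈ C, x' (y - x) ≤ F x y - F x x}

/-- The operator `ᶠA` of a bifunction on `C`. Only the values of `F` on `C × C` matter. -/
def leftOp (C : Set X) (F : X → X → ℝ) (x : X) : Set (StrongDual ℝ X) :=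
  {x' | x ∈ C ∧ ∀ y ∈ C, x' (y - x) ≤ F x x - F y x}

end MonotoneBifunction

namespace MonotoneBifunction

open Set Filter Topology

variable {X : Type*} [NormedAddCommGroup X] [NormedSpace ℝ X]

/-! Concavity in the first variable turns a subgradient inequality for `F x` into one for `-F · x`,
after a limit along segments. The two operators therefore coincide, and adding their inequalities
gives monotonicity.

For maximality, let `p` at `x₀` be monotonically related to `A^F`, and let `c` be a point of the
sqri with `L = cone (C - c)`. By Baire, convex lsc functions on `C` are bounded above near `c`
relative to `L`. Hahn–Banach in `L × ℝ` then yields a subgradient wherever an affine bound towards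
`c` holds, in particular at every point of a segment in `C` ending at `c`, except perhaps its start.
If `x₀ ∈ C`, testing `p` at such points and passing to the limit gives `p ∈ A^F x₀`. If `x₀ ∉ C`,
some element of `A^F` contradicts the relation. -/

/-! ### Limits along segments and equality of the two operators -/

theorem convexOn_lineMap_le {C : Set X} {f : X → ℝ} (hf : ConvexOn ℝ C f) {x y : X} (hx : x ∈ C)
    (hy : y ∈ C) {t : ℝ} (ht₀ : 0 ≤ t) (ht₁ : t ≤ 1) :
    f (x + t • (y - x)) ≤ (1 - t) * f x + t * f y := by
  have h := hf.2 hx hy (sub_nonneg.2 ht₁) ht₀ (by ring)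
  have e : x + t • (y - x) = (1 - t) • x + t • y := by module
  rw [e]
  simpa using h

/-- A lower semicontinuous function bounded above along a segment by a continuous function is
bounded above at the starting point. -/
theorem le_of_lowerSemicontinuousOn_segment {C : Set X} (hC : Convex ℝ C) {f : X → ℝ}
    (hf : LowerSemicontinuousOn f C) {x y : X} (hx : x ∈ C) (hy : y ∈ C) {g : ℝ → ℝ}
    (hg : ContinuousAt g 0) (h : ∀ t ∈ Ioo (0 : ℝ) 1, f (x + t • (y - x)) ≤ g t) :
    f x ≤ g 0 := by
  by_contra! hlt
  obtain ⟨m, hgm, hmf⟩ := exists_between hlt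
  have hcont : Continuous fun t : ℝ => x + t • (y - x) := by fun_prop
  have hI : ∀ᶠ t : ℝ in 𝓝[>] 0, t ∈ Ioo (0 : ℝ) 1 := Ioo_mem_nhdsGT one_pos
  have htend : Tendsto (fun t : ℝ => x + t • (y - x)) (𝓝[>] 0) (𝓝[C] x) := by
    refine tendsto_nhdsWithin_iff.2 ⟨?_, hI.mono fun t ht =>
      hC.add_smul_sub_mem hx hy ⟨ht.1.le, ht.2.le⟩⟩
    have := hcont.tendsto 0
    simp only [zero_smul, add_zero] at this
    exact this.mono_left nhdsWithin_le_nhds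
  have h₁ := htend.eventually (hf x hx m hmf)
  have h₂ : ∀ᶠ t in 𝓝[>] (0 : ℝ), g t < m :=
    nhdsWithin_le_nhds (hg.eventually (gt_mem_nhds hgm))
  obtain ⟨t, ht, ht₁, ht₂⟩ := (hI.and (h₁.and h₂)).exists
  exact absurd (h t ht) (by linarith)

/-- At `z = x + t • (y - x)`, concavity gives `(1 - t) F(x,z) + t F(y,z) ≤ F(z,z) = 0`, while
`F(x,z) ≥ t q(y - x)`. Divide by `t` and let `t → 0`. -/
theorem rightOp_subset_leftOp {C : Set X} (hC : Convex ℝ C) {F : X → X → ℝ}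
    (hdiag : ∀ x ∈ C, F x x = 0)
    (hlsc : ∀ x ∈ C, LowerSemicontinuousOn (fun y => F x y) C)
    (hconcave : ∀ y ∈ C, ConcaveOn ℝ C (fun x => F x y)) (x : X) :
    rightOp C F x ⊆ leftOp C F x := by
  rintro q ⟨hx, hq⟩
  refine ⟨hx, fun y hy => ?_⟩
  rw [hdiag x hx] at hq ⊢
  have key := le_of_lowerSemicontinuousOn_segment hC (hlsc y hy) hx hy
    (g := fun t => -((1 - t) * q (y - x))) (by fun_prop) fun t ht => ?_
  · simp only [sub_zero, one_mul] at key
    linarith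
  · have hz := hC.add_smul_sub_mem hx hy ⟨ht.1.le, ht.2.le⟩
    have h₁ := hq _ hz
    have h₂ := convexOn_lineMap_le (hconcave _ hz).neg hx hy ht.1.le ht.2.le
    simp only [Pi.neg_apply, hdiag _ hz] at h₂
    simp only [add_sub_cancel_left, map_smul, smul_eq_mul, sub_zero] at h₁
    have h₃ : t * ((1 - t) * q (y - x)) ≤ t * -F y (x + t • (y - x)) := by
      nlinarith [mul_le_mul_of_nonneg_left h₁ (sub_nonneg.2 ht.2.le)]
    have := le_of_mul_le_mul_left h₃ ht.1
    linarith

theorem rightOp_eq_leftOp {C : Set X} (hC : Convex ℝ C) {F : X → X → ℝ}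
    (hdiag : ∀ x ∈ C, F x x = 0)
    (hconvex : ∀ x ∈ C, ConvexOn ℝ C (fun y => F x y))
    (hlsc : ∀ x ∈ C, LowerSemicontinuousOn (fun y => F x y) C)
    (hconcave : ∀ y ∈ C, ConcaveOn ℝ C (fun x => F x y))
    (husc : ∀ y ∈ C, UpperSemicontinuousOn (fun x => F x y) C) :
    rightOp C F = leftOp C F := by
  funext x
  refine (rightOp_subset_leftOp hC hdiag hlsc hconcave x).antisymm ?_
  -- Passing to `-F(y,x)` exchanges the two operators and preserves the hypotheses.
  have h := rightOp_subset_leftOp hC (F := fun x y => -F y x) (by simpa using hdiag)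
    (fun y hy x hx m hm => (husc y hy x hx (-m) (by linarith)).mono fun z hz => by linarith)
    (fun x hx => (hconvex x hx).neg) x
  rintro q ⟨hx, hq⟩
  obtain ⟨-, hq'⟩ := h ⟨hx, fun y hy => by linarith [hq y hy]⟩
  exact ⟨hx, fun y hy => by linarith [hq' y hy]⟩

theorem isMonotoneOperator_rightOp {C : Set X} {F : X → X → ℝ}
    (hdiag : ∀ x ∈ C, F x x = 0) (heq : rightOp C F = leftOp C F) :
    IsMonotoneOperator (rightOp C F) := by
  intro x y p hp q hq
  rw [heq] at hq
  have h₁ := hp.2 y hq.1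
  have h₂ := hq.2 x hp.1
  rw [hdiag x hp.1] at h₁
  rw [hdiag y hq.1] at h₂
  simp only [map_sub, sub_apply] at *
  linarith

/-! ### Boundedness near a point of the sqri -/

/-- In a Banach space, a closed convex absorbing set is a neighbourhood of the origin. -/
theorem mem_nhds_zero_of_convex_closed_absorbing {V : Type*} [NormedAddCommGroup V]
    [NormedSpace ℝ V] [CompleteSpace V] {S : Set V} (hconv : Convex ℝ S) (hclosed : IsClosed S)
    (habs : ∀ v : V, ∃ t : ℝ, 0 < t ∧ t • v ∈ S) : S ∈ 𝓝 0 := by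
  have h0 : (0 : V) ∈ S := by
    obtain ⟨t, -, ht⟩ := habs 0
    simpa using ht
  -- The dilates of `S` cover the space, so by Baire `S` has an interior point `y`; then `0` lies
  -- between `y` and a point `t • -y` of `S`.
  have hU : ⋃ n : ℕ, {v : V | ((n : ℝ) + 1)⁻¹ • v ∈ S} = univ := by
    refine eq_univ_of_forall fun v => mem_iUnion.2 ?_
    obtain ⟨t, ht, hv⟩ := habs v
    obtain ⟨n, hn⟩ := exists_nat_one_div_lt ht
    refine ⟨n, ?_⟩
    rw [one_div] at hn
    have hs : (((n : ℝ) + 1)⁻¹ / t) • (t • v) ∈ S :=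
      hconv.smul_mem_of_zero_mem h0 hv ⟨by positivity, (div_le_one ht).2 hn.le⟩
    rwa [smul_smul, div_mul_cancel₀ _ ht.ne'] at hs
  obtain ⟨n, x, hx⟩ := nonempty_interior_of_iUnion_of_closed
    (fun n : ℕ => hclosed.preimage (continuous_const_smul (((n : ℝ) + 1)⁻¹))) hU
  have hn : ((n : ℝ) + 1)⁻¹ ≠ 0 := by positivity
  have hy : ((n : ℝ) + 1)⁻¹ • x ∈ interior S := by
    have := (Homeomorph.smulOfNeZero _ hn).preimage_interior S ▸ hx
    exact this
  set y := ((n : ℝ) + 1)⁻¹ • x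
  obtain ⟨t, ht, hty⟩ := habs (-y)
  have h := hconv.combo_interior_self_mem_interior hy hty (a := t / (1 + t)) (b := 1 / (1 + t))
    (by positivity) (by positivity) (by field_simp; ring)
  have e : (t / (1 + t)) • y + (1 / (1 + t)) • t • -y = 0 := by
    module
  rw [e] at h
  exact mem_interior_iff_mem_nhds.1 h

theorem sub_mem_of_coneHull_eq {C : Set X} {c : X} {L : Submodule ℝ X}
    (hL : coneHull ((fun u => u - c) '' C) = (L : Set X)) {y : X} (hy : y ∈ C) : y - c ∈ L := by
  have : y - c ∈ coneHull ((fun u => u - c) '' C) :=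
    ⟨1, zero_le_one, y - c, ⟨y, hy, rfl⟩, (one_smul ℝ _).symm⟩
  rwa [hL] at this

theorem exists_add_smul_mem_of_coneHull_eq {C : Set X} {c : X} (hc : c ∈ C) {L : Submodule ℝ X}
    (hL : coneHull ((fun u => u - c) '' C) = (L : Set X)) {l : X} (hl : l ∈ L) :
    ∃ t : ℝ, 0 < t ∧ c + t • l ∈ C := by
  have : l ∈ coneHull ((fun u => u - c) '' C) := by rwa [hL]
  obtain ⟨t, ht, -, ⟨u, hu, rfl⟩, rfl⟩ := this
  rcases ht.eq_or_lt with rfl | ht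
  · exact ⟨1, one_pos, by simpa using hc⟩
  · refine ⟨t⁻¹, inv_pos.2 ht, ?_⟩
    rwa [smul_smul, inv_mul_cancel₀ ht.ne', one_smul, add_sub_cancel]

/-- A convex lower semicontinuous function on a closed convex set is bounded above near a point of
the strong quasi relative interior, relative to the subspace generated by the set. -/
theorem eventually_mem_and_le_add_one [CompleteSpace X] {C : Set X} (hCclosed : IsClosed C)
    {c : X} (hc : c ∈ C) {L : Submodule ℝ X} (hLclosed : IsClosed (L : Set X))
    (hL : coneHull ((fun u => u - c) '' C) = (L : Set X)) {f : X → ℝ} (hf : ConvexOn ℝ C f)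
    (hlsc : LowerSemicontinuousOn f C) :
    ∀ᶠ l : L in 𝓝 0, c + (l : X) ∈ C ∧ f (c + l) ≤ f c + 1 := by
  have : CompleteSpace L := hLclosed.completeSpace_coe
  have hsub : IsClosed {y | y ∈ C ∧ f y ≤ f c + 1} := by
    obtain ⟨v, hv, hCv⟩ := lowerSemicontinuousOn_iff_preimage_Iic.1 hlsc (f c + 1)
    have : {y | y ∈ C ∧ f y ≤ f c + 1} = C ∩ v := by rw [← hCv]; rfl
    rw [this]
    exact hCclosed.inter hv
  have hcont : Continuous fun l : L => c + (l : X) := by fun_prop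
  refine mem_nhds_zero_of_convex_closed_absorbing (V := L) ?_ (hsub.preimage hcont) ?_
  · intro a ha b hb s t hs ht hst
    have h := (hf.convex_le (f c + 1)) ha hb hs ht hst
    have e : s • (c + (a : X)) + t • (c + (b : X)) = c + ((s • a + t • b : L) : X) := by
      have hs' : s = 1 - t := by linarith
      subst hs'
      push_cast
      module
    rw [e] at h
    exact h
  · intro l
    obtain ⟨t, ht, hmem⟩ := exists_add_smul_mem_of_coneHull_eq hc hL l.2
    -- By convexity, shrinking the step by `D` leaves an increase of at most 1.
    set D := |f (c + t • (l : X)) - f c| + 1 with hD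
    have hD1 : 1 ≤ D := by rw [hD]; linarith [abs_nonneg (f (c + t • (l : X)) - f c)]
    have hD0 : 0 < D := by linarith
    have hDi : D⁻¹ ≤ 1 := inv_le_one_of_one_le₀ hD1
    have hDp : 0 < D⁻¹ := inv_pos.2 hD0
    have e : c + ((D⁻¹ * t) • l : L) = c + D⁻¹ • ((c + t • (l : X)) - c) := by
      push_cast
      module
    refine ⟨D⁻¹ * t, by positivity, ?_⟩
    change c + (((D⁻¹ * t) • l : L) : X) ∈ C ∧ f (c + (((D⁻¹ * t) • l : L) : X)) ≤ f c + 1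
    rw [e]
    refine ⟨hf.1.add_smul_sub_mem hc hmem ⟨hDp.le, hDi⟩, ?_⟩
    have h := convexOn_lineMap_le hf hc hmem hDp.le hDi
    have h₂ : D⁻¹ * (f (c + t • (l : X)) - f c) ≤ D⁻¹ * D :=
      mul_le_mul_of_nonneg_left (by rw [hD]; linarith [le_abs_self (f (c + t • (l : X)) - f c)])
        hDp.le
    rw [inv_mul_cancel₀ hD0.ne'] at h₂
    linarith

/-! ### Existence of subgradients -/

/-- Existence of a subgradient at `x` from an affine minorant along the line joining `x` to a
point `c` of the strong quasi relative interior. -/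
theorem exists_subgradient_of_line_bound [CompleteSpace X] {C : Set X} (hCclosed : IsClosed C)
    {c : X} (hc : c ∈ C) {L : Submodule ℝ X} (hLclosed : IsClosed (L : Set X))
    (hL : coneHull ((fun u => u - c) '' C) = (L : Set X)) {f : X → ℝ} (hf : ConvexOn ℝ C f)
    (hlsc : LowerSemicontinuousOn f C) {x : X} (hx : x ∈ C) {I : Set ℝ} (hI : Convex ℝ I)
    (h0 : (0 : ℝ) ∈ I) (h1 : (1 : ℝ) ∈ I) {κ : ℝ}
    (hκ : ∀ s ∈ I, x + s • (c - x) ∈ C → f x + s * κ ≤ f (x + s • (c - x))) :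
    ∃ q : StrongDual ℝ X, (∀ y ∈ C, q (y - x) ≤ f y - f x) ∧ ∀ s ∈ I, s * κ ≤ s * q (c - x) := by
  have hmemL : ∀ y ∈ C, y - x ∈ L := fun y hy => by
    simpa using L.sub_mem (sub_mem_of_coneHull_eq hL hy) (sub_mem_of_coneHull_eq hL hx)
  set v : L := ⟨c - x, hmemL c hc⟩ with hv
  set E : Set (L × ℝ) := {p | x + (p.1 : X) ∈ C ∧ f (x + p.1) ≤ p.2} with hE
  set T : Set (L × ℝ) := (fun s : ℝ => ((s • v, f x + s * κ) : L × ℝ)) '' I with hT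
  have hEconv : Convex ℝ E := by
    intro a ha b hb s t hs ht hst
    have h := hf.convex_epigraph (x := (x + (a.1 : X), a.2)) ha (y := (x + (b.1 : X), b.2)) hb
      hs ht hst
    have e : s • (x + (a.1 : X)) + t • (x + (b.1 : X)) = x + ((s • a.1 + t • b.1 : L) : X) := by
      have hs' : s = 1 - t := by linarith
      subst hs'
      push_cast
      module
    simp only [Prod.smul_mk, Prod.mk_add_mk, mem_ofPred_eq, e] at h
    exact h
  have hTconv : Convex ℝ T := by
    rintro - ⟨a, ha, rfl⟩ - ⟨b, hb, rfl⟩ s t hs ht hst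
    refine ⟨s • a + t • b, hI ha hb hs ht hst, ?_⟩
    have hs' : s = 1 - t := by linarith
    subst hs'
    ext1
    · simp only [Prod.fst_add, Prod.smul_fst, smul_eq_mul]
      module
    · simp only [Prod.snd_add, Prod.smul_snd, smul_eq_mul]
      ring
  have hinterior : (v, f c + 2) ∈ interior E := by
    rw [mem_interior_iff_mem_nhds]
    have h := eventually_mem_and_le_add_one hCclosed hc hLclosed hL hf hlsc
    have ht : Tendsto (fun p : L × ℝ => p.1 - v) (𝓝 (v, f c + 2)) (𝓝 0) := by
      have : Continuous fun p : L × ℝ => p.1 - v := by fun_prop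
      simpa using this.tendsto (v, f c + 2)
    have ht₂ : ∀ᶠ p : L × ℝ in 𝓝 (v, f c + 2), f c + 1 < p.2 :=
      continuous_snd.continuousAt.eventually (lt_mem_nhds (by simp))
    filter_upwards [ht.eventually h, ht₂] with p hp hp₂
    have e : c + ((p.1 - v : L) : X) = x + (p.1 : X) := by
      simp only [hv, Submodule.coe_sub]
      abel
    rw [e] at hp
    exact ⟨hp.1, by linarith [hp.2]⟩
  -- A common point could be lowered slightly within the epigraph, below the affine minorant.
  have hdisj : Disjoint (interior E) T := by
    rw [Set.disjoint_left]
    rintro - hp ⟨s, hs, rfl⟩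
    have hcont : Continuous fun ε : ℝ => ((s • v, f x + s * κ - ε) : L × ℝ) := by fun_prop
    have hnear : ∀ᶠ ε : ℝ in 𝓝[>] 0, ((s • v, f x + s * κ - ε) : L × ℝ) ∈ E := by
      refine nhdsWithin_le_nhds (hcont.continuousAt.eventually ?_)
      simp only [sub_zero]
      exact mem_interior_iff_mem_nhds.1 hp
    obtain ⟨ε, hεE, hε⟩ := (hnear.and self_mem_nhdsWithin).exists
    have h := hκ s hs hεE.1
    have h₂ : f (x + s • (c - x)) ≤ f x + s * κ - ε := hεE.2
    have : (0 : ℝ) < ε := hε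
    linarith
  obtain ⟨φ, u, hφE, hφT⟩ := geometric_hahn_banach_open hEconv.interior isOpen_interior hTconv hdisj
  have hφE' : ∀ p ∈ E, φ p ≤ u := fun p hp => by
    refine closure_minimal (fun z hz => (hφE z hz).le) (isClosed_Iic.preimage φ.continuous) ?_
    rw [hEconv.closure_interior_eq_closure_of_nonempty_interior ⟨_, hinterior⟩]
    exact subset_closure hp
  set ψ : StrongDual ℝ L := φ.comp (ContinuousLinearMap.inl ℝ L ℝ) with hψ
  set α : ℝ := φ (0, 1) with hα
  have hφ : ∀ l m, φ (l, m) = ψ l + m * α := fun l m => by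
    have : ((l, m) : L × ℝ) = (l, 0) + m • (0, 1) := by simp
    rw [this, map_add, map_smul]
    rfl
  have hκ1 : f x + κ ≤ f c := by simpa using hκ 1 h1 (by simpa using hc)
  -- The hyperplane is not vertical: over `v`, the interior point of `E` lies strictly above the
  -- point of `T`.
  have hαneg : α < 0 := by
    have h₁ := hφE _ hinterior
    have h₂ := hφT _ ⟨1, h1, rfl⟩
    rw [hφ] at h₁
    simp only [hφ, one_smul, one_mul] at h₂
    nlinarith
  have hxE : ψ 0 + f x * α ≤ u := by
    rw [← hφ]
    exact hφE' _ ⟨by simpa using hx, by simp⟩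
  have hxT : u ≤ ψ 0 + f x * α := by
    simpa [hφ] using hφT _ ⟨0, h0, rfl⟩
  rw [map_zero, zero_add] at hxE hxT
  obtain ⟨q, hq, -⟩ := exists_extension_norm_eq L ((-α)⁻¹ • ψ)
  have hα' : 0 < -α := neg_pos.2 hαneg
  have hqψ : ∀ l : L, -α * q l = ψ l := fun l => by
    rw [hq]
    simp only [smul_apply, smul_eq_mul]
    rw [mul_inv_cancel_left₀ hα'.ne']
  refine ⟨q, fun y hy => ?_, fun s hs => ?_⟩
  · have h := hφE' (⟨y - x, hmemL y hy⟩, f y) ⟨by simpa using hy, by simp⟩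
    rw [hφ, ← hqψ] at h
    refine le_of_mul_le_mul_left ?_ hα'
    simp only at h
    linarith
  · have h := hφT _ ⟨s, hs, rfl⟩
    rw [hφ, map_smul, ← hqψ] at h
    refine le_of_mul_le_mul_left ?_ hα'
    simp only [smul_eq_mul, hv] at h
    linarith

/-- `A^F` is nonempty at every point of a half-open segment ending at a point of the strong quasi
relative interior. -/
theorem rightOp_segment_nonempty [CompleteSpace X] {C : Set X} (hCclosed : IsClosed C)
    {c : X} (hc : c ∈ C) {L : Submodule ℝ X} (hLclosed : IsClosed (L : Set X))
    (hL : coneHull ((fun u => u - c) '' C) = (L : Set X)) {F : X → X → ℝ}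
    (hconvex : ∀ x ∈ C, ConvexOn ℝ C (fun y => F x y))
    (hlsc : ∀ x ∈ C, LowerSemicontinuousOn (fun y => F x y) C) {z : X} (hz : z ∈ C) {s : ℝ}
    (hs₀ : 0 < s) (hs₁ : s ≤ 1) : (rightOp C F (z + s • (c - z))).Nonempty := by
  have hx := (hconvex z hz).1.add_smul_sub_mem hz hc ⟨hs₀.le, hs₁⟩
  set x := z + s • (c - z) with hxdef
  -- The slope is that of the secant of `F x` from `z` to `x`, rescaled from `x - z` to `c - x`;
  -- convexity keeps `F x` above it beyond `x`.
  have hline : ∀ r ∈ Icc (0 : ℝ) 1, x + r • (c - x) ∈ C →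
      F x x + r * ((1 - s) / s * (F x x - F x z)) ≤ F x (x + r • (c - x)) := by
    intro r hr hw
    set w := x + r • (c - x) with hwdef
    have hr' : 0 ≤ r * (1 - s) := mul_nonneg hr.1 (by linarith)
    have hd : 0 < s + r * (1 - s) := by linarith
    have e : z + (s / (s + r * (1 - s))) • (w - z) = x := by
      have : w - z = (s + r * (1 - s)) • (c - z) := by
        rw [hwdef, hxdef]
        module
      rw [this, smul_smul, div_mul_cancel₀ _ hd.ne']
    have h := convexOn_lineMap_le (hconvex x hx) hz hw (t := s / (s + r * (1 - s)))
      (by positivity) ((div_le_one hd).2 (by linarith))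
    rw [e] at h
    have h₂ : (s + r * (1 - s)) * F x x ≤ r * (1 - s) * F x z + s * F x w := by
      have := mul_le_mul_of_nonneg_left h hd.le
      field_simp at this
      linarith
    have h₃ : s * (F x x + r * ((1 - s) / s * (F x x - F x z))) ≤ s * F x w := by
      have : s * (F x x + r * ((1 - s) / s * (F x x - F x z))) =
          s * F x x + r * (1 - s) * (F x x - F x z) := by
        field_simp
      rw [this]
      linarith
    exact le_of_mul_le_mul_left h₃ hs₀
  obtain ⟨q, hq, -⟩ := exists_subgradient_of_line_bound hCclosed hc hLclosed hL (hconvex x hx)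
    (hlsc x hx) hx (convex_Icc (0 : ℝ) 1) (by simp) (by simp) hline
  exact ⟨q, hx, hq⟩

/-! ### Points monotonically related to the operator -/

/-- An upper semicontinuous function bounded below along a segment by a continuous function is
bounded below at the starting point. -/
theorem ge_of_upperSemicontinuousOn_segment {C : Set X} (hC : Convex ℝ C) {f : X → ℝ}
    (hf : UpperSemicontinuousOn f C) {x y : X} (hx : x ∈ C) (hy : y ∈ C) {g : ℝ → ℝ}
    (hg : ContinuousAt g 0) (h : ∀ t ∈ Ioo (0 : ℝ) 1, g t ≤ f (x + t • (y - x))) :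
    g 0 ≤ f x := by
  have := le_of_lowerSemicontinuousOn_segment hC (f := fun z => -f z) (g := fun t => -g t)
    (fun z hz m hm => (hf z hz (-m) (by linarith)).mono fun w hw => by linarith) hx hy hg.neg
    fun t ht => neg_le_neg (h t ht)
  linarith

theorem mem_rightOp_of_monotonicallyRelated_of_mem [CompleteSpace X] {C : Set X}
    (hCconv : Convex ℝ C) (hCclosed : IsClosed C)
    {c : X} (hc : c ∈ C) {L : Submodule ℝ X} (hLclosed : IsClosed (L : Set X))
    (hL : coneHull ((fun u => u - c) '' C) = (L : Set X)) {F : X → X → ℝ}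
    (hdiag : ∀ x ∈ C, F x x = 0)
    (hconvex : ∀ x ∈ C, ConvexOn ℝ C (fun y => F x y))
    (hlsc : ∀ x ∈ C, LowerSemicontinuousOn (fun y => F x y) C)
    (husc : ∀ y ∈ C, UpperSemicontinuousOn (fun x => F x y) C)
    {x₀ : X} (hx₀ : x₀ ∈ C) {p : StrongDual ℝ X}
    (hrel : ∀ x, ∀ q ∈ rightOp C F x, p (x - x₀) ≤ q (x - x₀)) : p ∈ rightOp C F x₀ := by
  have hseg : ∀ y ∈ C, ∀ s ∈ Ioo (0 : ℝ) 1,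
      p (y + s • (c - y) - x₀) ≤ F x₀ (y + s • (c - y)) := by
    intro y hy s hs
    have hd := hCconv.add_smul_sub_mem hy hc ⟨hs.1.le, hs.2.le⟩
    set d := y + s • (c - y) with hddef
    have key := ge_of_upperSemicontinuousOn_segment hCconv (husc d hd) hx₀ hd
      (g := fun t => (1 - t) * p (d - x₀)) (by fun_prop) fun t ht => ?_
    · simpa using key
    · have hts : 0 < 1 - t * s := by nlinarith [ht.1, ht.2, hs.1, hs.2]
      have hz : ((1 - t) / (1 - t * s)) • x₀ + (t * (1 - s) / (1 - t * s)) • y ∈ C :=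
        hCconv hx₀ hy (div_nonneg (by linarith [ht.2]) hts.le)
          (div_nonneg (mul_nonneg ht.1.le (by linarith [hs.2])) hts.le)
          (by field_simp; ring)
      -- Chosen so that `x₀ + t • (d - x₀)` lies on the segment from `z` to `c`, with weight `t * s
      -- > 0` at `c`.
      set z := ((1 - t) / (1 - t * s)) • x₀ + (t * (1 - s) / (1 - t * s)) • y with hzdef
      have hzmul : (1 - t * s) • z = (1 - t) • x₀ + (t * (1 - s)) • y := by
        rw [hzdef, smul_add, smul_smul, smul_smul, mul_div_cancel₀ _ hts.ne',
          mul_div_cancel₀ _ hts.ne']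
      have e : z + (t * s) • (c - z) = x₀ + t • (d - x₀) := by
        have : z + (t * s) • (c - z) = (1 - t * s) • z + (t * s) • c := by module
        rw [this, hzmul, hddef]
        module
      obtain ⟨q, hq⟩ := rightOp_segment_nonempty hCclosed hc hLclosed hL hconvex hlsc hz
        (mul_pos ht.1 hs.1) (by linarith)
      rw [e] at hq
      have h₁ := hrel _ q hq
      have h₂ := hq.2 d hd
      rw [hdiag _ hq.1, show d - (x₀ + t • (d - x₀)) = (1 - t) • (d - x₀) by module,
        map_smul, smul_eq_mul] at h₂
      rw [add_sub_cancel_left, map_smul, map_smul, smul_eq_mul, smul_eq_mul] at h₁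
      have h₃ := le_of_mul_le_mul_left h₁ ht.1
      have h₄ := mul_le_mul_of_nonneg_left h₃ (sub_nonneg.2 ht.2.le)
      linarith
  refine ⟨hx₀, fun y hy => ?_⟩
  rw [hdiag _ hx₀, sub_zero]
  have hbound : ∀ s ∈ Ioo (0 : ℝ) 1,
      p (y - x₀) + s * p (c - y) ≤ (1 - s) * F x₀ y + s * F x₀ c := by
    intro s hs
    have h := (hseg y hy s hs).trans
      (convexOn_lineMap_le (hconvex x₀ hx₀) hy hc hs.1.le hs.2.le)
    rwa [show y + s • (c - y) - x₀ = (y - x₀) + s • (c - y) by module, map_add, map_smul,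
      smul_eq_mul] at h
  have hleft : Tendsto (fun s : ℝ => p (y - x₀) + s * p (c - y)) (𝓝[>] 0) (𝓝 (p (y - x₀))) := by
    have : Continuous fun s : ℝ => p (y - x₀) + s * p (c - y) := by fun_prop
    simpa using (this.tendsto 0).mono_left nhdsWithin_le_nhds
  have hright : Tendsto (fun s : ℝ => (1 - s) * F x₀ y + s * F x₀ c) (𝓝[>] 0) (𝓝 (F x₀ y)) := by
    have : Continuous fun s : ℝ => (1 - s) * F x₀ y + s * F x₀ c := by fun_prop
    simpa using (this.tendsto 0).mono_left nhdsWithin_le_nhds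
  exact le_of_tendsto_of_tendsto hleft hright
    (Filter.mem_of_superset (Ioo_mem_nhdsGT one_pos) hbound)

theorem mem_of_monotonicallyRelated_rightOp [CompleteSpace X] {C : Set X}
    (hCconv : Convex ℝ C) (hCclosed : IsClosed C)
    {c : X} (hc : c ∈ C) {L : Submodule ℝ X} (hLclosed : IsClosed (L : Set X))
    (hL : coneHull ((fun u => u - c) '' C) = (L : Set X)) {F : X → X → ℝ}
    (hdiag : ∀ x ∈ C, F x x = 0)
    (hconvex : ∀ x ∈ C, ConvexOn ℝ C (fun y => F x y))
    (hlsc : ∀ x ∈ C, LowerSemicontinuousOn (fun y => F x y) C)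
    (husc : ∀ y ∈ C, UpperSemicontinuousOn (fun x => F x y) C)
    {x₀ : X} {p : StrongDual ℝ X}
    (hrel : ∀ x, ∀ q ∈ rightOp C F x, p (x - x₀) ≤ q (x - x₀)) : x₀ ∈ C := by
  by_contra hx₀
  by_cases hLx : x₀ - c ∈ L
  · -- the first point `b` of `C` on the segment from `x₀` to `c`
    have hcompact : IsCompact {t : ℝ | t ∈ Icc (0 : ℝ) 1 ∧ x₀ + t • (c - x₀) ∈ C} :=
      isCompact_Icc.inter_right (hCclosed.preimage (by fun_prop))
    obtain ⟨τ, ⟨⟨hτ₀, hτ₁⟩, hb⟩, hleast⟩ := hcompact.exists_isLeast ⟨1, by simpa using hc⟩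
    have hτpos : 0 < τ := by
      refine hτ₀.lt_of_ne fun h => hx₀ ?_
      simpa [← h] using hb
    have hτlt : τ < 1 := by
      obtain ⟨r, hr, hrC⟩ := exists_add_smul_mem_of_coneHull_eq hc hL hLx
      set ρ := min r 1
      have hρ : 0 < ρ := lt_min hr one_pos
      have hρC : c + ρ • (x₀ - c) ∈ C := by
        have h := hCconv.add_smul_sub_mem hc hrC (t := ρ / r)
          ⟨by positivity, (div_le_one hr).2 (min_le_left _ _)⟩
        rwa [add_sub_cancel_left, smul_smul, div_mul_cancel₀ _ hr.ne'] at h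
      have := hleast (a := 1 - ρ) ⟨⟨by linarith [min_le_right r 1], by linarith⟩, by
        rwa [show x₀ + (1 - ρ) • (c - x₀) = c + ρ • (x₀ - c) by module]⟩
      linarith
    set b := x₀ + τ • (c - x₀) with hbdef
    have hcb : c - b = (1 - τ) • (c - x₀) := by rw [hbdef]; module
    have hτ' : 0 < 1 - τ := by linarith
    have hline : ∀ s : ℝ, 0 ≤ s → s ≤ 1 → s * p (c - b) ≤ F b (b + s • (c - b)) := by
      intro s hs₀ hs₁
      have hy := hCconv.add_smul_sub_mem hb hc ⟨hs₀, hs₁⟩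
      rcases hs₀.eq_or_lt with rfl | hs₀
      · simp [hdiag b hb]
      have key := ge_of_upperSemicontinuousOn_segment hCconv (husc _ hy) hb hy
        (g := fun t => s * (1 - t) * p (c - b)) (by fun_prop) fun t ht => ?_
      · simpa using key
      · obtain ⟨q, hq⟩ := rightOp_segment_nonempty hCclosed hc hLclosed hL hconvex hlsc hb
          (mul_pos ht.1 hs₀) (by nlinarith [ht.1, ht.2])
        have h₁ := hrel _ q hq
        have h₂ := hq.2 _ hy
        rw [show b + t • (b + s • (c - b) - b) = b + (t * s) • (c - b) by module]
        rw [hdiag _ hq.1, sub_zero, show b + s • (c - b) - (b + (t * s) • (c - b)) =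
          (s * (1 - t)) • (c - b) by module, map_smul, smul_eq_mul] at h₂
        have e : b + (t * s) • (c - b) - x₀ = (τ / (1 - τ) + t * s) • (c - b) := by
          rw [add_smul, hcb, smul_smul (τ / (1 - τ)), div_mul_cancel₀ _ hτ'.ne', hbdef]
          module
        rw [e, map_smul, map_smul, smul_eq_mul, smul_eq_mul] at h₁
        have h₃ := le_of_mul_le_mul_left h₁
          (add_pos (div_pos hτpos hτ') (mul_pos ht.1 hs₀))
        have h₄ := mul_le_mul_of_nonneg_left h₃
          (mul_nonneg hs₀.le (sub_nonneg.2 ht.2.le))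
        linarith
    -- For `s < 0` the point falls before `b`, outside `C`, so the bound is vacuous and any `κ ≤ p
    -- (c - b)` is admissible. The value `s = -τ` forces `q (c - b) ≤ κ < p (c - b)`, whereas `hrel`
    -- at `b` gives the opposite.
    obtain ⟨q, hq, hqv⟩ := exists_subgradient_of_line_bound hCclosed hc hLclosed hL
      (hconvex b hb) (hlsc b hb) hb (convex_Icc (-τ) 1) ⟨by linarith, by linarith⟩
      ⟨by linarith, le_rfl⟩ (κ := p (c - b) - 1) fun s hs hmem => by
        rw [hdiag b hb, zero_add]
        rcases le_or_gt 0 s with hs₀ | hs₀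
        · linarith [hline s hs₀ hs.2]
        · exfalso
          have e : b + s • (c - b) = x₀ + (τ + s * (1 - τ)) • (c - x₀) := by
            rw [hcb, hbdef]
            module
          rw [e] at hmem
          have := hleast ⟨⟨by nlinarith [hs.1], by nlinarith⟩, hmem⟩
          nlinarith
    have h₁ := hrel b q ⟨hb, hq⟩
    have h₂ := hqv (-τ) ⟨le_rfl, by linarith⟩
    have e : b - x₀ = (τ / (1 - τ)) • (c - b) := by
      rw [hcb, smul_smul, div_mul_cancel₀ _ hτ'.ne', hbdef]
      module
    rw [e, map_smul, map_smul, smul_eq_mul, smul_eq_mul] at h₁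
    have h₃ := le_of_mul_le_mul_left h₁ (div_pos hτpos hτ')
    nlinarith
  · -- a functional vanishing on `L` can be added to any element of `A^F c`
    obtain ⟨n, u, hnL, hn⟩ := geometric_hahn_banach_closed_point L.convex hLclosed hLx
    have hu : 0 < u := by simpa using hnL 0 L.zero_mem
    have hzero : ∀ l ∈ L, n l = 0 := by
      intro l hl
      by_contra hne
      have := hnL ((u / n l) • l) (L.smul_mem _ hl)
      rw [map_smul, smul_eq_mul, div_mul_cancel₀ _ hne] at this
      exact lt_irrefl _ this
    obtain ⟨q, hq⟩ := rightOp_segment_nonempty hCclosed hc hLclosed hL hconvex hlsc hc one_pos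
      le_rfl
    rw [sub_self, smul_zero, add_zero] at hq
    have hpos : 0 < n (x₀ - c) := hu.trans hn
    -- Large enough for `q + r • n` to violate `hrel` at `c`.
    set r := (|q (c - x₀) - p (c - x₀)| + 1) / n (x₀ - c) with hr
    have h := hrel c (q + r • n) ⟨hc, fun y hy => by
      simpa [hzero _ (sub_mem_of_coneHull_eq hL hy)] using hq.2 y hy⟩
    have hrn : r * n (x₀ - c) = |q (c - x₀) - p (c - x₀)| + 1 := div_mul_cancel₀ _ hpos.ne'
    have hneg : n (c - x₀) = -n (x₀ - c) := by rw [← map_neg, neg_sub]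
    rw [add_apply, smul_apply, smul_eq_mul, hneg] at h
    linarith [le_abs_self (q (c - x₀) - p (c - x₀))]

end MonotoneBifunction

theorem mainTheorem1 {X : Type*} [NormedAddCommGroup X] [NormedSpace ℝ X] [CompleteSpace X]
    (C : Set X) (hCconv : Convex ℝ C) (hCclosed : IsClosed C)
    (hCsqri : (MonotoneBifunction.sqri C).Nonempty)
    (F : X → X → ℝ)
    (hFdiag : ∀ x ∈ C, F x x = 0)
    (hFconvex : ∀ x ∈ C, ConvexOn ℝ C (fun y => F x y))
    (hFlsc : ∀ x ∈ C, LowerSemicontinuousOn (fun y => F x y) C)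
    (hFconcave : ∀ y ∈ C, ConcaveOn ℝ C (fun x => F x y))
    (hFusc : ∀ y ∈ C, UpperSemicontinuousOn (fun x => F x y) C) :
    MonotoneBifunction.IsMaximalMonotone (MonotoneBifunction.rightOp C F) ∧
      MonotoneBifunction.rightOp C F = MonotoneBifunction.leftOp C F := by
  obtain ⟨c, hc, L, hLclosed, hL⟩ := hCsqri
  have heq := MonotoneBifunction.rightOp_eq_leftOp hCconv hFdiag hFconvex hFlsc hFconcave hFusc
  refine ⟨⟨MonotoneBifunction.isMonotoneOperator_rightOp hFdiag heq, fun S hS hAS => ?_⟩, heq⟩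
  obtain ⟨hsub, hne⟩ := hAS
  refine hne fun ⟨x₀, p⟩ hp => ?_
  have hrel : ∀ x, ∀ q ∈ MonotoneBifunction.rightOp C F x, p (x - x₀) ≤ q (x - x₀) := by
    intro x q hq
    have h := hS x₀ x p hp q (hsub (a := (x, q)) hq)
    rwa [sub_apply, sub_nonneg] at h
  exact MonotoneBifunction.mem_rightOp_of_monotonicallyRelated_of_mem hCconv hCclosed hc hLclosed
    hL hFdiag hFconvex hFlsc hFusc (MonotoneBifunction.mem_of_monotonicallyRelated_rightOp hCconv
      hCclosed hc hLclosed hL hFdiag hFconvex hFlsc hFusc hrel) hrel
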